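/- Let $\mathcal X$ be a real or complex Banach space with $\dim\mathcal X\ge 2$. Let $\mathcal N$ be a nest on $\mathcal X$, that is, a chain of closed subspaces of $\mathcal X$ that contains $\{0\}$ and $\mathcal X$ and is closed under arbitrary intersections and arbitrary closed linear spans. Let $\mathrm{Alg}\,\mathcal N$ be the algebra of all bounded linear operators on $\mathcal X$ that leave every member of $\mathcal N$ invariant. For $N\in\mathcal N$ let $N_-$ be the closed linear span of all $M\in\mathcal N$ with $M\subsetneq N$, and assume that every $N\in\mathcal N$ with $N_-=N$ is complemented in $\mathcal X$. Let $\tau,\delta,\rho:\mathrm{Alg}\,\mathcal N\to\mathrm{Alg}\,\mathcal N$ be linear maps (not assumed continuous). (i) $\tau$ satisfies $AB=0\Rightarrow A\tau(B)=0$ for all $A,B\in\mathrm{Alg}\,\mathcal N$ if and only if there is $D\in\mathrm{Alg}\,\mathcal N$ such that $\tau(A)=AD$ for all $A\in\mathrm{Alg}\,\mathcal N$. (ii) $\delta$ satisfies $AB=0\Rightarrow \delta(A)B=0$ for all $A,B\in\mathrm{Alg}\,\mathcal N$ if and only if there is $D\in\mathrm{Alg}\,\mathcal N$ such that $\delta(A)=DA$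 for all $A\in\mathrm{Alg}\,\mathcal N$. (iii) $\rho$ satisfies $AB=0\Rightarrow A\rho(B)=\rho(A)B=0$ for all $A,B\in\mathrm{Alg}\,\mathcal N$ if and only if there is $D\in\mathrm{Alg}\,\mathcal N$ such that $\rho(A)=AD$ and $AD=DA$ for all $A\in\mathrm{Alg}\,\mathcal N$. -/

import Mathlib

section NestAlgebra

variable {𝕜 X : Type*} [RCLike 𝕜] [NormedAddCommGroup X] [NormedSpace 𝕜 X]

/-- A nest on `X`: a chain of closed subspaces containing `{0}` and `X`, and closed under
arbitrary intersections and arbitrary closed linear spans. -/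
structure IsNest (𝒩 : Set (Submodule 𝕜 X)) : Prop where
  isClosed : ∀ N ∈ 𝒩, IsClosed (N : Set X)
  isChain : IsChain (· ≤ ·) 𝒩
  bot_mem : ⊥ ∈ 𝒩
  top_mem : ⊤ ∈ 𝒩
  sInf_mem : ∀ S ⊆ 𝒩, sInf S ∈ 𝒩
  closure_sSup_mem : ∀ S ⊆ 𝒩, (sSup S).topologicalClosure ∈ 𝒩

/-- `N₋`, the closed linear span of all members of `𝒩` strictly contained in `N`. -/
def nestPred (𝒩 : Set (Submodule 𝕜 X)) (N : Submodule 𝕜 X) : Submodule 𝕜 X :=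
  (sSup {M | M ∈ 𝒩 ∧ M < N}).topologicalClosure

/-- `Alg 𝒩`, the algebra of all bounded operators on `X` leaving every member of `𝒩`
invariant. -/
def nestAlgebra (𝒩 : Set (Submodule 𝕜 X)) : Subalgebra 𝕜 (X →L[𝕜] X) where
  carrier := {T | ∀ N ∈ 𝒩, ∀ x ∈ N, T x ∈ N}
  mul_mem' hS hT N hN x hx := hS N hN _ (hT N hN x hx)
  add_mem' hS hT N hN x hx := N.add_mem (hS N hN x hx) (hT N hN x hx)
  algebraMap_mem' c N _ x hx := by
    simpa [Algebra.algebraMap_eq_smul_one] using N.smul_mem c hx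

end NestAlgebra

/-!
Let `τ` satisfy `a * b = 0 → a * τ b = 0`. For an idempotent `p`, the zero products
`(1 - p) * (p * b)` and `p * (b - p * b)` give `τ (p * b) = p * τ b`, and the `r` with
`τ (r * b) = r * τ b` for all `b` form a subalgebra. If `S` is a set of such `r` that is stable
under right multiplication by the algebra, then `s * τ a = τ (s * a) = s * a * τ 1` for `s ∈ S`, so
that `τ a = a * τ 1` as soon as `S * m = 0` forces `m = 0`.

In `Alg 𝒩` take for `S` the operators `f ⊗ x : y ↦ f y • x` with `x ∈ N` and `f` vanishing on `N₋`.
No nonzero operator is annihilated by `S` on the left, because the `N₋` with `N ≠ 0` intersect in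
`0`, or on the right, because the `N` with `N₋ ≠ X` span a dense subspace. If `N₋ ≠ N`, there is an
idempotent `e = g ⊗ y` in `S` and `f ⊗ x = (g ⊗ x) * e * (f ⊗ y)`; the corners `e * a * e` are
multiples of `e`, and the off-diagonal Peirce components of any `a` are differences of idempotents.
If `N₋ = N`, a projection `p` onto `N` has `f ⊗ x = p * (f ⊗ x) * (1 - p)`, which is such an
off-diagonal component.
-/

section Idempotents

variable (𝕜 : Type*) {𝒜 M : Type*} [CommRing 𝕜] [Ring 𝒜] [Algebra 𝕜 𝒜]

variable (𝒜) in
/-- The subalgebra generated by the idempotents of an algebra: the linear maps of interest commute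
with multiplication by its elements. -/
def idempotentSubalgebra : Subalgebra 𝕜 𝒜 :=
  Algebra.adjoin 𝕜 {p | IsIdempotentElem p}

theorem mem_idempotentSubalgebra {p : 𝒜} (hp : IsIdempotentElem p) :
    p ∈ idempotentSubalgebra 𝕜 𝒜 :=
  Algebra.subset_adjoin hp

theorem op_mem_idempotentSubalgebra {r : 𝒜} (hr : r ∈ idempotentSubalgebra 𝕜 𝒜) :
    MulOpposite.op r ∈ idempotentSubalgebra 𝕜 𝒜ᵐᵒᵖ := by
  have hr' : MulOpposite.op r ∈ (idempotentSubalgebra 𝕜 𝒜).op := hr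
  rw [idempotentSubalgebra, Subalgebra.op_adjoin] at hr'
  exact Algebra.adjoin_mono (fun p hp => MulOpposite.unop_injective hp) hr'

theorem mul_mul_one_sub_mem_idempotentSubalgebra {e : 𝒜} (he : IsIdempotentElem e) (a : 𝒜) :
    e * a * (1 - e) ∈ idempotentSubalgebra 𝕜 𝒜 := by
  have hsum : IsIdempotentElem (e + e * a * (1 - e)) := by
    have h₁ : e * (e * a * (1 - e)) = e * a * (1 - e) := by simp only [← mul_assoc, he.eq]
    have h₂ : e * a * (1 - e) * e = 0 := by rw [mul_assoc, he.one_sub_mul_self, mul_zero]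
    have h₃ : e * a * (1 - e) * (e * a * (1 - e)) = 0 := by
      rw [← mul_assoc, ← mul_assoc, h₂, zero_mul, zero_mul]
    rw [IsIdempotentElem, add_mul, mul_add, mul_add, he.eq, h₁, h₂, h₃, add_zero, add_zero]
  simpa only [add_sub_cancel_left] using
    sub_mem (mem_idempotentSubalgebra 𝕜 hsum) (mem_idempotentSubalgebra 𝕜 he)

theorem mul_mul_mem_idempotentSubalgebra {e a b : 𝒜} (he : IsIdempotentElem e)
    (ha : e * a * e ∈ idempotentSubalgebra 𝕜 𝒜) (hb : e * b * e ∈ idempotentSubalgebra 𝕜 𝒜) :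
    a * e * b ∈ idempotentSubalgebra 𝕜 𝒜 := by
  have hae : a * e ∈ idempotentSubalgebra 𝕜 𝒜 := by
    have h := mul_mul_one_sub_mem_idempotentSubalgebra 𝕜 he.one_sub a
    convert add_mem ha h using 1
    noncomm_ring
  have heb : e * b ∈ idempotentSubalgebra 𝕜 𝒜 := by
    convert add_mem hb (mul_mul_one_sub_mem_idempotentSubalgebra 𝕜 he b) using 1
    noncomm_ring
  have hfactor : a * e * b = a * e * (e * b) := by
    rw [mul_assoc a e (e * b), he.mul_self_mul, mul_assoc]
  exact hfactor ▸ mul_mem hae heb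

variable {𝕜} [AddCommGroup M] [Module 𝕜 M]

theorem map_mul_eq_smul_of_mem_idempotentSubalgebra [Module 𝒜 M] [IsScalarTower 𝕜 𝒜 M]
    {τ : 𝒜 →ₗ[𝕜] M} (hτ : ∀ a b, a * b = 0 → a • τ b = 0) {r : 𝒜}
    (hr : r ∈ idempotentSubalgebra 𝕜 𝒜) (b : 𝒜) : τ (r * b) = r • τ b := by
  induction hr using Algebra.adjoin_induction generalizing b with
  | mem p hp =>
    have hp : IsIdempotentElem p := hp
    have h₁ : τ (p * b) = p • τ (p * b) := by
      have := hτ (1 - p) (p * b) (by rw [← mul_assoc, hp.one_sub_mul_self, zero_mul])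
      rwa [sub_smul, one_smul, sub_eq_zero] at this
    have h₂ : p • τ b = p • τ (p * b) := by
      have := hτ p (b - p * b) (by rw [mul_sub, hp.mul_self_mul, sub_self])
      rwa [map_sub, smul_sub, sub_eq_zero] at this
    rw [h₁, h₂]
  | algebraMap c => rw [algebraMap_smul, ← Algebra.smul_def, map_smul]
  | add x y _ _ hx hy => rw [add_mul, map_add, hx, hy, add_smul]
  | mul x y _ _ hx hy => rw [mul_assoc, hx, hy, mul_smul]

theorem map_eq_smul_map_one [Module 𝒜 M] [IsScalarTower 𝕜 𝒜 M] {τ : 𝒜 →ₗ[𝕜] M}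
    (hτ : ∀ a b, a * b = 0 → a • τ b = 0) {S : Set 𝒜}
    (hS : S ⊆ idempotentSubalgebra 𝕜 𝒜) (hmul : ∀ s ∈ S, ∀ a, s * a ∈ S)
    (hsep : ∀ m : M, (∀ s ∈ S, s • m = 0) → m = 0) (a : 𝒜) : τ a = a • τ 1 := by
  refine sub_eq_zero.1 (hsep _ fun s hs => ?_)
  rw [smul_sub, sub_eq_zero]
  calc s • τ a = τ (s * a * 1) := by
        rw [mul_one, map_mul_eq_smul_of_mem_idempotentSubalgebra hτ (hS hs)]
    _ = s • a • τ 1 := by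
        rw [map_mul_eq_smul_of_mem_idempotentSubalgebra hτ (hS (hmul s hs a)), mul_smul]

theorem map_eq_op_smul_map_one [Module 𝒜ᵐᵒᵖ M] [IsScalarTower 𝕜 𝒜ᵐᵒᵖ M] {δ : 𝒜 →ₗ[𝕜] M}
    (hδ : ∀ a b, a * b = 0 → MulOpposite.op b • δ a = 0) {S : Set 𝒜}
    (hS : S ⊆ idempotentSubalgebra 𝕜 𝒜) (hmul : ∀ s ∈ S, ∀ a, a * s ∈ S)
    (hsep : ∀ m : M, (∀ s ∈ S, MulOpposite.op s • m = 0) → m = 0) (a : 𝒜) :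
    δ a = MulOpposite.op a • δ 1 :=
  map_eq_smul_map_one (τ := δ ∘ₗ (MulOpposite.opLinearEquiv 𝕜).symm.toLinearMap)
    (S := MulOpposite.unop ⁻¹' S)
    (fun b a hba => hδ a.unop b.unop (congrArg MulOpposite.unop hba))
    (fun _ hs => op_mem_idempotentSubalgebra 𝕜 (hS hs))
    (fun s hs a => hmul s.unop hs a.unop)
    (fun m hm => hsep m fun s hs => hm (MulOpposite.op s) hs) (MulOpposite.op a)

end Idempotents

theorem exists_strongDual_le_ker_of_notMem {𝕜 X : Type*} [RCLike 𝕜] [SeminormedAddCommGroup X]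
    [NormedSpace 𝕜 X] {M : Submodule 𝕜 X} (hM : IsClosed (M : Set X)) {y : X} (hy : y ∉ M) :
    ∃ f : StrongDual 𝕜 X, M ≤ f.ker ∧ f y = 1 := by
  have : IsClosed (M : Set X) := hM
  obtain ⟨g, hg⟩ := SeparatingDual.exists_eq_one (R := 𝕜) (x := M.mkQL y) (by simpa using hy)
  refine ⟨g.comp M.mkQL, fun x hx => ?_, hg⟩
  have hx' : M.mkQL x = 0 := by simpa using hx
  rw [LinearMap.mem_ker, ContinuousLinearMap.coe_coe, ContinuousLinearMap.comp_apply, hx', map_zero]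

section NestRankOne

variable {𝕜 X : Type*} [RCLike 𝕜] [NormedAddCommGroup X] [NormedSpace 𝕜 X]
  {𝒩 : Set (Submodule 𝕜 X)} {N : Submodule 𝕜 X}

theorem isClosed_nestPred (𝒩 : Set (Submodule 𝕜 X)) (N : Submodule 𝕜 X) :
    IsClosed (nestPred 𝒩 N : Set X) :=
  Submodule.isClosed_topologicalClosure _

theorem nestPred_le_iff {K : Submodule 𝕜 X} (hK : IsClosed (K : Set X)) :
    nestPred 𝒩 N ≤ K ↔ ∀ M ∈ 𝒩, M < N → M ≤ K := by
  refine ⟨fun h M hM hMN => ?_, fun h => ?_⟩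
  · exact (le_sSup (show M ∈ {M | M ∈ 𝒩 ∧ M < N} from ⟨hM, hMN⟩)).trans
      ((Submodule.le_topologicalClosure _).trans h)
  · exact Submodule.topologicalClosure_minimal _ (sSup_le fun M hM => h M hM.1 hM.2) hK

theorem le_nestPred {M : Submodule 𝕜 X} (hM : M ∈ 𝒩) (hMN : M < N) : M ≤ nestPred 𝒩 N :=
  (nestPred_le_iff (isClosed_nestPred 𝒩 N)).1 le_rfl M hM hMN

theorem nestPred_le (hN : IsClosed (N : Set X)) : nestPred 𝒩 N ≤ N :=
  (nestPred_le_iff hN).2 fun _ _ hMN => hMN.le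

theorem apply_mem_nestPred (A : nestAlgebra 𝒩) {z : X} (hz : z ∈ nestPred 𝒩 N) :
    (A : X →L[𝕜] X) z ∈ nestPred 𝒩 N := by
  have hclosed := (isClosed_nestPred 𝒩 N).preimage (A : X →L[𝕜] X).continuous
  refine (nestPred_le_iff (K := (nestPred 𝒩 N).comap (A : X →L[𝕜] X).toLinearMap) hclosed).2
    (fun M hM hMN y hy => ?_) hz
  exact le_nestPred hM hMN (A.2 M hM y hy)

theorem IsNest.iInf_nestPred_eq_bot (h𝒩 : IsNest 𝒩) :
    ⨅ N ∈ {N | N ∈ 𝒩 ∧ N ≠ ⊥}, nestPred 𝒩 N = ⊥ := by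
  let K : Submodule 𝕜 X := sInf {N | N ∈ 𝒩 ∧ N ≠ ⊥}
  have hmem : K ∈ 𝒩 := h𝒩.sInf_mem _ fun _ hN => hN.1
  have hle : ⨅ N ∈ {N | N ∈ 𝒩 ∧ N ≠ ⊥}, nestPred 𝒩 N ≤ K :=
    le_sInf fun N hN => (iInf₂_le N hN).trans (nestPred_le (h𝒩.isClosed N hN.1))
  by_cases hbot : K = ⊥
  · exact le_bot_iff.1 (hle.trans hbot.le)
  · have hpred : nestPred 𝒩 K ≤ ⊥ := by
      refine (nestPred_le_iff (h𝒩.isClosed _ h𝒩.bot_mem)).2 fun M hM hMK => ?_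
      by_contra hM0
      exact hMK.not_ge (sInf_le ⟨hM, fun h => hM0 h.le⟩)
    exact le_bot_iff.1 ((iInf₂_le K ⟨hmem, hbot⟩).trans hpred)

theorem IsNest.topologicalClosure_sSup_nestPred_ne_top (h𝒩 : IsNest 𝒩) :
    (sSup {N | N ∈ 𝒩 ∧ nestPred 𝒩 N ≠ ⊤}).topologicalClosure = ⊤ := by
  have hle : ∀ N ∈ 𝒩, nestPred 𝒩 N ≠ ⊤ →
      N ≤ (sSup {N | N ∈ 𝒩 ∧ nestPred 𝒩 N ≠ ⊤}).topologicalClosure :=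
    fun N hN hpred => le_trans (le_sSup (show N ∈ {N | N ∈ 𝒩 ∧ nestPred 𝒩 N ≠ ⊤} from ⟨hN, hpred⟩))
      (Submodule.le_topologicalClosure _)
  by_cases hpred : nestPred 𝒩 ⊤ = ⊤
  · refine top_le_iff.1 (hpred.ge.trans ?_)
    refine (nestPred_le_iff (Submodule.isClosed_topologicalClosure _)).2 fun M hM hMtop => ?_
    exact hle M hM ((nestPred_le (h𝒩.isClosed M hM)).trans_lt hMtop).ne
  · exact top_le_iff.1 (hle ⊤ h𝒩.top_mem hpred)

/-- The operators `f ⊗ x : y ↦ f y • x` with `x ∈ N` and `f` vanishing on `N₋` for some `N ∈ 𝒩`,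
as a subset of `Alg 𝒩`. For a nest these are the operators of rank at most one in `Alg 𝒩`. -/
def nestRankOne (𝒩 : Set (Submodule 𝕜 X)) : Set (nestAlgebra 𝒩) :=
  {T | ∃ N ∈ 𝒩, ∃ x ∈ N, ∃ f : StrongDual 𝕜 X, nestPred 𝒩 N ≤ f.ker ∧
    (T : X →L[𝕜] X) = f.smulRight x}

theorem nestRankOne_mul_mem {T : nestAlgebra 𝒩} (hT : T ∈ nestRankOne 𝒩) (A : nestAlgebra 𝒩) :
    T * A ∈ nestRankOne 𝒩 := by
  obtain ⟨N, hN, x, hx, f, hf, hT⟩ := hT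
  refine ⟨N, hN, x, hx, f.comp (A : X →L[𝕜] X), fun z hz => hf (apply_mem_nestPred A hz), ?_⟩
  rw [MulMemClass.coe_mul, hT]
  rfl

theorem mul_nestRankOne_mem {T : nestAlgebra 𝒩} (hT : T ∈ nestRankOne 𝒩) (A : nestAlgebra 𝒩) :
    A * T ∈ nestRankOne 𝒩 := by
  obtain ⟨N, hN, x, hx, f, hf, hT⟩ := hT
  refine ⟨N, hN, (A : X →L[𝕜] X) x, A.2 N hN x hx, f, hf, ?_⟩
  ext z
  simp [hT]

namespace IsNest

variable (h𝒩 : IsNest 𝒩)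
include h𝒩

theorem smulRight_mem_nestAlgebra (hN : N ∈ 𝒩) {x : X} (hx : x ∈ N) {f : StrongDual 𝕜 X}
    (hf : nestPred 𝒩 N ≤ f.ker) : f.smulRight x ∈ nestAlgebra 𝒩 := by
  intro M hM y hy
  by_cases hNM : N ≤ M
  · exact M.smul_mem _ (hNM hx)
  · have hMN : M < N := lt_of_le_not_ge ((h𝒩.isChain.total hM hN).resolve_right hNM) hNM
    have hfy : f y = 0 := hf (le_nestPred hM hMN hy)
    simp [hfy]

theorem exists_mem_nestRankOne (hN : N ∈ 𝒩) {x : X} (hx : x ∈ N) {f : StrongDual 𝕜 X}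
    (hf : nestPred 𝒩 N ≤ f.ker) :
    ∃ T ∈ nestRankOne 𝒩, (T : X →L[𝕜] X) = f.smulRight x :=
  ⟨⟨_, h𝒩.smulRight_mem_nestAlgebra hN hx hf⟩, ⟨N, hN, x, hx, f, hf, rfl⟩, rfl⟩

theorem eq_zero_of_nestRankOne_apply {z : X}
    (hz : ∀ T ∈ nestRankOne 𝒩, (T : X →L[𝕜] X) z = 0) : z = 0 := by
  rw [← Submodule.mem_bot 𝕜, ← h𝒩.iInf_nestPred_eq_bot]
  simp only [Submodule.mem_iInf]
  intro N hN
  by_contra hzN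
  obtain ⟨f, hf, hfz⟩ := exists_strongDual_le_ker_of_notMem (isClosed_nestPred 𝒩 N) hzN
  obtain ⟨x, hx, hx0⟩ := N.exists_mem_ne_zero_of_ne_bot hN.2
  obtain ⟨T, hT, hTf⟩ := h𝒩.exists_mem_nestRankOne hN.1 hx hf
  exact hx0 (by simpa [hTf, hfz] using hz T hT)

theorem eq_zero_of_nestRankOne_mul {B : nestAlgebra 𝒩} (hB : ∀ T ∈ nestRankOne 𝒩, T * B = 0) :
    B = 0 :=
  Subtype.ext <| ContinuousLinearMap.ext fun z => h𝒩.eq_zero_of_nestRankOne_apply fun T hT =>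
    congrArg (fun A : nestAlgebra 𝒩 => (A : X →L[𝕜] X) z) (hB T hT)

theorem eq_zero_of_mul_nestRankOne {B : nestAlgebra 𝒩} (hB : ∀ T ∈ nestRankOne 𝒩, B * T = 0) :
    B = 0 := by
  have hker : ∀ N ∈ {N | N ∈ 𝒩 ∧ nestPred 𝒩 N ≠ ⊤}, N ≤ (B : X →L[𝕜] X).ker := by
    rintro N ⟨hN, htop⟩ x hx
    obtain ⟨y, -, hy⟩ := SetLike.exists_of_lt (lt_top_iff_ne_top.2 htop)
    obtain ⟨f, hf, hfy⟩ := exists_strongDual_le_ker_of_notMem (isClosed_nestPred 𝒩 N) hy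
    obtain ⟨T, hT, hTf⟩ := h𝒩.exists_mem_nestRankOne hN hx hf
    have hBTy : ((B * T : nestAlgebra 𝒩) : X →L[𝕜] X) y = 0 := by rw [hB T hT]; rfl
    simpa [hTf, hfy] using hBTy
  have htop : ⊤ ≤ (B : X →L[𝕜] X).ker := h𝒩.topologicalClosure_sSup_nestPred_ne_top.ge.trans
    (Submodule.topologicalClosure_minimal _ (sSup_le hker) (B : X →L[𝕜] X).isClosed_ker)
  exact Subtype.ext (ContinuousLinearMap.ext fun z => htop (Submodule.mem_top (x := z)))

theorem smulRight_mem_idempotentSubalgebra_of_nestPred_ne (hN : N ∈ 𝒩) (hpred : nestPred 𝒩 N ≠ N)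
    {T : nestAlgebra 𝒩} {x : X} (hx : x ∈ N) {f : StrongDual 𝕜 X} (hf : nestPred 𝒩 N ≤ f.ker)
    (hT : (T : X →L[𝕜] X) = f.smulRight x) : T ∈ idempotentSubalgebra 𝕜 (nestAlgebra 𝒩) := by
  obtain ⟨y, hy, hy'⟩ :=
    SetLike.exists_of_lt (lt_of_le_of_ne (nestPred_le (h𝒩.isClosed N hN)) hpred)
  obtain ⟨g, hg, hgy⟩ := exists_strongDual_le_ker_of_notMem (isClosed_nestPred 𝒩 N) hy'
  obtain ⟨E, -, hE⟩ := h𝒩.exists_mem_nestRankOne hN hy hg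
  obtain ⟨A, -, hA⟩ := h𝒩.exists_mem_nestRankOne hN hx hg
  obtain ⟨B, -, hB⟩ := h𝒩.exists_mem_nestRankOne hN hy hf
  have hidem : IsIdempotentElem E := by ext z; simp [hE, hgy]
  have hcorner_left : E * A * E = g x • E := by ext z; simp [hE, hA, hgy, smul_smul, mul_comm]
  have hcorner_right : E * B * E = f y • E := by ext z; simp [hE, hB, hgy, smul_smul, mul_comm]
  have hfactor : T = A * E * B := by ext z; simp [hE, hA, hB, hT, hgy]
  have hE_mem := mem_idempotentSubalgebra 𝕜 hidem
  rw [hfactor]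
  exact mul_mul_mem_idempotentSubalgebra 𝕜 hidem (hcorner_left ▸ Subalgebra.smul_mem _ hE_mem _)
    (hcorner_right ▸ Subalgebra.smul_mem _ hE_mem _)

theorem exists_projection_mem_nestAlgebra (hN : N ∈ 𝒩) (hc : N.ClosedComplemented) :
    ∃ P : nestAlgebra 𝒩, (∀ z, (P : X →L[𝕜] X) z ∈ N) ∧ ∀ z ∈ N, (P : X →L[𝕜] X) z = z := by
  obtain ⟨π, hπ⟩ := hc
  have hπN : ∀ z ∈ N, (π z : X) = z := fun z hz => congrArg Subtype.val (hπ ⟨z, hz⟩)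
  refine ⟨⟨N.subtypeL.comp π, fun M hM z hz => ?_⟩, fun z => (π z).2, hπN⟩
  rcases h𝒩.isChain.total hM hN with hMN | hNM
  · simpa [hπN z (hMN hz)] using hz
  · exact hNM (π z).2

theorem smulRight_mem_idempotentSubalgebra_of_closedComplemented (hN : N ∈ 𝒩)
    (hc : N.ClosedComplemented) {T : nestAlgebra 𝒩} {x : X} (hx : x ∈ N) {f : StrongDual 𝕜 X}
    (hf : N ≤ f.ker) (hT : (T : X →L[𝕜] X) = f.smulRight x) :
    T ∈ idempotentSubalgebra 𝕜 (nestAlgebra 𝒩) := by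
  obtain ⟨P, hPN, hP⟩ := h𝒩.exists_projection_mem_nestAlgebra hN hc
  have hidem : IsIdempotentElem P := by ext z; exact hP _ (hPN z)
  have hPT : P * T = T := by ext z; simp [hT, hP x hx]
  have hTP : T * P = 0 := by
    ext z
    have hfP : f ((P : X →L[𝕜] X) z) = 0 := hf (hPN z)
    simp [hT, hfP]
  simpa [hPT, mul_sub, hTP] using mul_mul_one_sub_mem_idempotentSubalgebra 𝕜 hidem T

theorem nestRankOne_subset_idempotentSubalgebra
    (hcompl : ∀ N ∈ 𝒩, nestPred 𝒩 N = N → N.ClosedComplemented) :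
    nestRankOne 𝒩 ⊆ idempotentSubalgebra 𝕜 (nestAlgebra 𝒩) := by
  rintro T ⟨N, hN, x, hx, f, hf, hT⟩
  by_cases hpred : nestPred 𝒩 N = N
  · exact h𝒩.smulRight_mem_idempotentSubalgebra_of_closedComplemented hN (hcompl N hN hpred) hx
      (hpred ▸ hf) hT
  · exact h𝒩.smulRight_mem_idempotentSubalgebra_of_nestPred_ne hN hpred hx hf hT

theorem map_eq_mul_map_one (hcompl : ∀ N ∈ 𝒩, nestPred 𝒩 N = N → N.ClosedComplemented)
    {τ : nestAlgebra 𝒩 →ₗ[𝕜] nestAlgebra 𝒩} (hτ : ∀ A B, A * B = 0 → A * τ B = 0)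
    (A : nestAlgebra 𝒩) : τ A = A * τ 1 :=
  map_eq_smul_map_one hτ (h𝒩.nestRankOne_subset_idempotentSubalgebra hcompl)
    (fun _ => nestRankOne_mul_mem) (fun _ => h𝒩.eq_zero_of_nestRankOne_mul) A

theorem map_eq_map_one_mul (hcompl : ∀ N ∈ 𝒩, nestPred 𝒩 N = N → N.ClosedComplemented)
    {δ : nestAlgebra 𝒩 →ₗ[𝕜] nestAlgebra 𝒩} (hδ : ∀ A B, A * B = 0 → δ A * B = 0)
    (A : nestAlgebra 𝒩) : δ A = δ 1 * A :=
  map_eq_op_smul_map_one hδ (h𝒩.nestRankOne_subset_idempotentSubalgebra hcompl)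
    (fun _ => mul_nestRankOne_mem) (fun _ => h𝒩.eq_zero_of_mul_nestRankOne) A

end IsNest

end NestRankOne

theorem corollary3p3_general {𝕜 X : Type*} [RCLike 𝕜] [NormedAddCommGroup X] [NormedSpace 𝕜 X]
    {𝒩 : Set (Submodule 𝕜 X)} (h𝒩 : IsNest 𝒩)
    (hcompl : ∀ N ∈ 𝒩, nestPred 𝒩 N = N → N.ClosedComplemented)
    (τ δ ρ : nestAlgebra 𝒩 →ₗ[𝕜] nestAlgebra 𝒩) :
    ((∀ A B : nestAlgebra 𝒩, A * B = 0 → A * τ B = 0) ↔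
      ∃ D : nestAlgebra 𝒩, ∀ A : nestAlgebra 𝒩, τ A = A * D) ∧
    ((∀ A B : nestAlgebra 𝒩, A * B = 0 → δ A * B = 0) ↔
      ∃ D : nestAlgebra 𝒩, ∀ A : nestAlgebra 𝒩, δ A = D * A) ∧
    ((∀ A B : nestAlgebra 𝒩, A * B = 0 → A * ρ B = 0 ∧ ρ A * B = 0) ↔
      ∃ D : nestAlgebra 𝒩, (∀ A : nestAlgebra 𝒩, ρ A = A * D) ∧
        ∀ A : nestAlgebra 𝒩, A * D = D * A) := by
  refine ⟨⟨fun h => ⟨τ 1, h𝒩.map_eq_mul_map_one hcompl h⟩, ?_⟩,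
    ⟨fun h => ⟨δ 1, h𝒩.map_eq_map_one_mul hcompl h⟩, ?_⟩, ⟨fun h => ⟨ρ 1, ?_⟩, ?_⟩⟩
  · rintro ⟨D, hD⟩ A B hAB
    rw [hD, ← mul_assoc, hAB, zero_mul]
  · rintro ⟨D, hD⟩ A B hAB
    rw [hD, mul_assoc, hAB, mul_zero]
  · have hleft := h𝒩.map_eq_mul_map_one hcompl fun A B hAB => (h A B hAB).1
    have hright := h𝒩.map_eq_map_one_mul hcompl fun A B hAB => (h A B hAB).2
    exact ⟨hleft, fun A => (hleft A).symm.trans (hright A)⟩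
  · rintro ⟨D, hD, hcomm⟩ A B hAB
    refine ⟨?_, ?_⟩
    · rw [hD, ← mul_assoc, hAB, zero_mul]
    · rw [hD, hcomm, mul_assoc, hAB, mul_zero]

theorem corollary3p3 {𝕜 X : Type*} [RCLike 𝕜] [NormedAddCommGroup X] [NormedSpace 𝕜 X]
    [CompleteSpace X] (hdim : 2 ≤ Module.rank 𝕜 X)
    (𝒩 : Set (Submodule 𝕜 X)) (h𝒩 : IsNest 𝒩)
    (hcompl : ∀ N ∈ 𝒩, nestPred 𝒩 N = N → N.ClosedComplemented)
    (τ δ ρ : nestAlgebra 𝒩 →ₗ[𝕜] nestAlgebra 𝒩) :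
    ((∀ A B : nestAlgebra 𝒩, A * B = 0 → A * τ B = 0) ↔
      ∃ D : nestAlgebra 𝒩, ∀ A : nestAlgebra 𝒩, τ A = A * D) ∧
    ((∀ A B : nestAlgebra 𝒩, A * B = 0 → δ A * B = 0) ↔
      ∃ D : nestAlgebra 𝒩, ∀ A : nestAlgebra 𝒩, δ A = D * A) ∧
    ((∀ A B : nestAlgebra 𝒩, A * B = 0 → A * ρ B = 0 ∧ ρ A * B = 0) ↔
      ∃ D : nestAlgebra 𝒩, (∀ A : nestAlgebra 𝒩, ρ A = A * D) ∧
        ∀ A : nestAlgebra 𝒩, A * D = D * A) :=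
  corollary3p3_general h𝒩 hcompl τ δ ρ
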